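/- For $n\ge 1$ let $G_n$ be the $n\times n$ matrix with entries $(G_n)_{j,k}=1$ if $j+k\le n$ and $(G_n)_{j,k}=-1$ otherwise ($1\le j,k\le n$). For a real $n\times n$ matrix $M$ and a probability distribution $\mu=(\mu_{j,k})$ on $[n]\times[n]$ put $$\mathsf{disc}_\mu(M)=\max_{x,y\in\mathbb C^n:\ \|x\|_\infty=\|y\|_\infty=1}\Big|\sum_{j,k}M_{j,k}\,\mu_{j,k}\,x_j y_k\Big|,\qquad \mathsf{disc}(M)=\inf_\mu \mathsf{disc}_\mu(M).$$ For a bounded Borel function $\nu:[0,1)\to\mathbb C$ (regarded as the density of an absolutely continuous complex measure) put $\hat\nu(\ell)=\int_0^1 e^{2\pi i\ell t}\nu(t)\,dt$ for $\ell\in\mathbb Z$, and $\|\nu\|=\sup_f\big|\int_0^1\nu(t)f(t)\,dt\big|$ over Borel functions $f:[0,1)\to\mathbb C$ with $\|f\|_\infty=1$. Then: (1) As $n\to\infty$, $$\mathsf{disc}(G_n)=(1-o(1))\,\frac{\pi}{2\ln n}.$$ (2) For every $n$ with $\ln n>3$, let $H_{j,k}=\frac{1}{n+\frac12-j-k}$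 and $\mu^*_{j,k}=|H_{j,k}|\big/\sum_{j',k'}|H_{j',k'}|$. Then $\mu^*$ is a probability distribution on $[n]\times[n]$ and $$\mathsf{disc}_{\mu^*}(G_n)\le\frac{\pi}{2(\ln n-3)}.$$ (3) For every $n\ge1$ there is a bounded Borel function $\nu:[0,1)\to\mathbb C$ such that, for all integers $\ell$ with $|\ell|\le n$, $\hat\nu(\ell)=1$ if $\ell\ge0$ and $\hat\nu(\ell)=0$ if $\ell<0$; moreover $\|\nu\|\le\frac{\ln n}{\pi}+2$ and $\mathsf{disc}(G_n)\ge\frac{1}{2\|\nu\|}$. -/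

import Mathlib

open Real Set Filter Topology MeasureTheory Asymptotics

/-- The `n × n` signed greater-than matrix `G_{j,k} = 2·1_{j+k ≤ n} - 1`, `j, k ∈ {1, …, n}`.
The index `j : Fin n` stands for the number `j + 1`. -/
def greaterThan (n : ℕ) : Matrix (Fin n) (Fin n) ℝ :=
  fun j k => 2 * (if (j.val + 1) + (k.val + 1) ≤ n then 1 else 0) - 1

/-- The discrepancy of `M` with respect to weights `μ` on `[n] × [n]`: the maximum of
`|∑ M_{j,k} μ_{j,k} x_j y_k|` over complex vectors of sup-norm one
(`Fin n → ℂ` carries the sup-norm). -/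
noncomputable def discWith {n : ℕ} (μ : Fin n × Fin n → ℝ) (M : Matrix (Fin n) (Fin n) ℝ) : ℝ :=
  sSup {r : ℝ | ∃ x y : Fin n → ℂ, ‖x‖ = 1 ∧ ‖y‖ = 1 ∧
    r = ‖∑ j, ∑ k, (M j k : ℂ) * (μ (j, k) : ℂ) * x j * y k‖}

/-- The discrepancy of `M`: the infimum over all probability distributions on `[n] × [n]`. -/
noncomputable def disc {n : ℕ} (M : Matrix (Fin n) (Fin n) ℝ) : ℝ :=
  ⨅ μ : stdSimplex ℝ (Fin n × Fin n), discWith (μ : Fin n × Fin n → ℝ) M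

/-- The Hilbert-type matrix `H_{j,k} = 1 / (n + 1/2 - j - k)`, `j, k ∈ {1, …, n}`. -/
noncomputable def hilbertMatrix (n : ℕ) : Matrix (Fin n) (Fin n) ℝ :=
  fun j k => 1 / ((n : ℝ) + 1 / 2 - ((j.val : ℝ) + 1) - ((k.val : ℝ) + 1))

/-- The weights `|H_{j,k}| / ‖H‖₁`, with `‖H‖₁` the sum of the absolute values of the entries. -/
noncomputable def hilbertDist (n : ℕ) : Fin n × Fin n → ℝ :=
  fun p => |hilbertMatrix n p.1 p.2| / ∑ j, ∑ k, |hilbertMatrix n j k|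

/-- `ν` restricted to `[0,1)` is the density of an absolutely continuous complex measure:
it is Borel measurable and bounded (hence integrable) there. -/
structure IsComplexDensity (ν : ℝ → ℂ) : Prop where
  measurable : Measurable ν
  bounded : ∃ C : ℝ, ∀ t ∈ Ico (0 : ℝ) 1, ‖ν t‖ ≤ C

/-- The Fourier transform `ℓ ↦ ∫_0^1 e^{2πiℓt} ν(t) dt`. -/
noncomputable def densityFourier (ν : ℝ → ℂ) (l : ℤ) : ℂ :=
  ∫ t in Ico (0 : ℝ) 1, Complex.exp (2 * π * Complex.I * l * t) * ν t

/-- The norm `sup |∫_0^1 ν(t) f(t) dt|` over Borel `f` on `[0,1)` with sup-norm one. -/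
noncomputable def densityNorm (ν : ℝ → ℂ) : ℝ :=
  sSup {r : ℝ | ∃ f : ℝ → ℂ, Measurable f ∧ IsLUB ((fun t => ‖f t‖) '' Ico (0 : ℝ) 1) 1 ∧
    r = ‖∫ t in Ico (0 : ℝ) 1, ν t * f t‖}

/-! Both bounds come from Fourier analysis on the circle, where a matrix entry depending only on `n
- j - k` is a Fourier coefficient at that frequency.

Upper bound: `G` is the sign pattern of the Hilbert-type matrix `H`, so weights proportional to
`|H|` turn the form for `G` into that of `H` divided by `‖H‖₁`. The entries of `H` are Fourier
coefficients of a function of modulus `π`, so Parseval bounds the form by `π n`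
(`norm_hilbertMatrix_bilin_le`), while harmonic sums give `‖H‖₁ ≥ 2n (ln n - 1)`.

Lower bound: if the transform of `ν` is the step function on `[-n, n]`, then `G` is a difference of
two matrices of the form `ν̂(p_j + q_k)`, each an average against `ν` of rank-one products of
characters. Pairing with `G μ` gives `1 ≤ 2 ‖ν‖ disc_μ(G)`
(`one_le_two_mul_densityNorm_mul_discWith`). A suitable `ν` is half the sum of a sign kernel, with
norm of order `(2/π) ln n`, and a flat kernel of norm at most 2. The two bounds agree to leading
order. -/

/-! ### Characters, their integrals and Parseval's identity. -/

/-- The character `t ↦ e^{2πilt}` of the circle, as a function on the real line. -/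
noncomputable def circleChar (l : ℤ) (t : ℝ) : ℂ :=
  Complex.exp (2 * π * Complex.I * l * t)

@[fun_prop]
lemma continuous_circleChar (l : ℤ) : Continuous (circleChar l) := by
  unfold circleChar
  fun_prop

lemma norm_circleChar (l : ℤ) (t : ℝ) : ‖circleChar l t‖ = 1 := by
  have h : 2 * π * Complex.I * l * t = ((2 * π * l * t : ℝ) : ℂ) * Complex.I := by
    push_cast
    ring
  rw [circleChar, h, Complex.norm_exp_ofReal_mul_I]

lemma circleChar_add (k l : ℤ) (t : ℝ) :
    circleChar (k + l) t = circleChar k t * circleChar l t := by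
  rw [circleChar, circleChar, circleChar, ← Complex.exp_add]
  push_cast
  ring_nf

lemma conj_circleChar (l : ℤ) (t : ℝ) :
    (starRingEnd ℂ) (circleChar l t) = circleChar (-l) t := by
  rw [circleChar, circleChar, ← Complex.exp_conj]
  simp [Complex.conj_ofReal, map_ofNat]

lemma integrableOn_Ico_of_continuous {E : Type*} [NormedAddCommGroup E] {f : ℝ → E}
    (hf : Continuous f) : IntegrableOn f (Ico (0 : ℝ) 1) :=
  (hf.continuousOn.integrableOn_Icc (a := 0) (b := 1)).mono_set Ico_subset_Icc_self

lemma setIntegral_Ico_eq_intervalIntegral {E : Type*} [NormedAddCommGroup E] [NormedSpace ℝ E]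
    (f : ℝ → E) : ∫ t in Ico (0 : ℝ) 1, f t = ∫ t in (0 : ℝ)..1, f t := by
  rw [intervalIntegral.integral_of_le zero_le_one, integral_Ico_eq_integral_Ioo,
    integral_Ioc_eq_integral_Ioo]

lemma setIntegral_cexp_mul {c : ℂ} (hc : c ≠ 0) :
    ∫ t in Ico (0 : ℝ) 1, Complex.exp (c * t) = (Complex.exp c - 1) / c := by
  rw [setIntegral_Ico_eq_intervalIntegral, integral_exp_mul_complex hc]
  simp

lemma integral_circleChar (l : ℤ) :
    ∫ t in Ico (0 : ℝ) 1, circleChar l t = if l = 0 then 1 else 0 := by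
  unfold circleChar
  split_ifs with h
  · simp [h]
  · have h' : (l : ℂ) ≠ 0 := by exact_mod_cast h
    rw [setIntegral_cexp_mul (by simp [h', Real.pi_ne_zero])]
    have : Complex.exp (2 * π * Complex.I * l) = 1 := by
      rw [Complex.exp_eq_one_iff]
      exact ⟨l, by ring⟩
    simp [this]

/-- The numbers `1 / (m + 1/2)` are, up to a factor, the Fourier coefficients of `e^{πit}`. -/
lemma integral_half_mul_circleChar (m : ℤ) :
    -(Complex.I * π) * ∫ t in Ico (0 : ℝ) 1, Complex.exp (π * Complex.I * t) * circleChar m t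
      = 1 / ((m : ℂ) + 1 / 2) := by
  have h0 : (m : ℂ) + 1 / 2 ≠ 0 := by
    intro h
    have h2 : (2 * m + 1 : ℂ) = 0 := by linear_combination 2 * h
    have h3 : 2 * m + 1 = 0 := by exact_mod_cast h2
    omega
  have hpi : (π : ℂ) ≠ 0 := by simp [Real.pi_ne_zero]
  have hc : 2 * π * Complex.I * ((m : ℂ) + 1 / 2) ≠ 0 :=
    mul_ne_zero (by simp [hpi]) h0
  have hf : ∀ t : ℝ, Complex.exp (π * Complex.I * t) * circleChar m t
      = Complex.exp (2 * π * Complex.I * ((m : ℂ) + 1 / 2) * t) := by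
    intro t
    rw [circleChar, ← Complex.exp_add]
    ring_nf
  have he : Complex.exp (2 * π * Complex.I * ((m : ℂ) + 1 / 2)) = -1 := by
    have : 2 * π * Complex.I * ((m : ℂ) + 1 / 2) = m * (2 * π * Complex.I) + π * Complex.I := by
      ring
    rw [this, Complex.exp_add, Complex.exp_int_mul_two_pi_mul_I, Complex.exp_pi_mul_I, one_mul]
  simp_rw [hf]
  rw [setIntegral_cexp_mul hc, he]
  have h3 : (m : ℂ) * 2 + 1 ≠ 0 := fun h => h0 (by linear_combination h / 2)
  field_simp
  ring

/-- Parseval's identity for trigonometric polynomials. -/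
lemma integral_norm_sq_trigPoly {ι : Type*} (s : Finset ι) (p : ι → ℤ) (hp : Set.InjOn p s)
    (x : ι → ℂ) :
    ∫ t in Ico (0 : ℝ) 1, ‖∑ i ∈ s, x i * circleChar (p i) t‖ ^ 2 = ∑ i ∈ s, ‖x i‖ ^ 2 := by
  classical
  have h : ∀ t : ℝ, ((‖∑ i ∈ s, x i * circleChar (p i) t‖ ^ 2 : ℝ) : ℂ)
      = ∑ i ∈ s, ∑ j ∈ s, x i * (starRingEnd ℂ) (x j) * circleChar (p i - p j) t := by
    intro t
    rw [Complex.ofReal_pow, ← Complex.mul_conj', map_sum, Finset.sum_mul_sum]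
    refine Finset.sum_congr rfl fun i _ => Finset.sum_congr rfl fun j _ => ?_
    rw [map_mul, conj_circleChar, sub_eq_add_neg, circleChar_add]
    ring
  apply Complex.ofReal_injective
  rw [← integral_complex_ofReal]
  simp_rw [h]
  rw [integral_finsetSum _ fun i _ => integrableOn_Ico_of_continuous (by fun_prop)]
  push_cast
  refine Finset.sum_congr rfl fun i hi => ?_
  rw [integral_finsetSum _ fun i _ => integrableOn_Ico_of_continuous (by fun_prop)]
  simp_rw [integral_const_mul, integral_circleChar]
  rw [Finset.sum_eq_single_of_mem i hi]
  · simp [Complex.mul_conj']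
  · intro j hj hji
    rw [if_neg, mul_zero]
    intro h0
    exact hji (hp hi hj (by omega)).symm

/-- AM-GM in place of Cauchy–Schwarz: it costs nothing when both square integrals have the same
bound, as for the Hilbert form. -/
lemma integral_norm_mul_le {f g : ℝ → ℂ} (hf : Continuous f) (hg : Continuous g) :
    ∫ t in Ico (0 : ℝ) 1, ‖f t‖ * ‖g t‖ ≤
      ((∫ t in Ico (0 : ℝ) 1, ‖f t‖ ^ 2) + ∫ t in Ico (0 : ℝ) 1, ‖g t‖ ^ 2) / 2 := by
  rw [← integral_add (integrableOn_Ico_of_continuous (by fun_prop))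
    (integrableOn_Ico_of_continuous (by fun_prop)), ← integral_div]
  refine integral_mono (integrableOn_Ico_of_continuous (by fun_prop))
    (integrableOn_Ico_of_continuous (by fun_prop)) fun t => ?_
  change ‖f t‖ * ‖g t‖ ≤ (‖f t‖ ^ 2 + ‖g t‖ ^ 2) / 2
  nlinarith [sq_nonneg (‖f t‖ - ‖g t‖)]

/-! ### Discrepancy and the norm of a density. -/

lemma bddAbove_discWith {n : ℕ} (μ : Fin n × Fin n → ℝ) (M : Matrix (Fin n) (Fin n) ℝ) :
    BddAbove {r : ℝ | ∃ x y : Fin n → ℂ, ‖x‖ = 1 ∧ ‖y‖ = 1 ∧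
      r = ‖∑ j, ∑ k, (M j k : ℂ) * (μ (j, k) : ℂ) * x j * y k‖} := by
  refine ⟨∑ j, ∑ k, ‖M j k‖ * ‖μ (j, k)‖, ?_⟩
  rintro r ⟨x, y, hx, hy, rfl⟩
  refine (norm_sum_le _ _).trans (Finset.sum_le_sum fun j _ => (norm_sum_le _ _).trans
    (Finset.sum_le_sum fun k _ => ?_))
  have hxj : ‖x j‖ ≤ 1 := hx ▸ norm_le_pi_norm x j
  have hyk : ‖y k‖ ≤ 1 := hy ▸ norm_le_pi_norm y k
  simp only [norm_mul, Complex.norm_real]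
  calc ‖M j k‖ * ‖μ (j, k)‖ * ‖x j‖ * ‖y k‖ ≤ ‖M j k‖ * ‖μ (j, k)‖ * 1 * 1 := by gcongr
    _ = _ := by ring

lemma le_discWith {n : ℕ} (μ : Fin n × Fin n → ℝ) (M : Matrix (Fin n) (Fin n) ℝ)
    {x y : Fin n → ℂ} (hx : ‖x‖ = 1) (hy : ‖y‖ = 1) :
    ‖∑ j, ∑ k, (M j k : ℂ) * (μ (j, k) : ℂ) * x j * y k‖ ≤ discWith μ M :=
  le_csSup (bddAbove_discWith μ M) ⟨x, y, hx, hy, rfl⟩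

lemma discWith_nonneg {n : ℕ} (μ : Fin n × Fin n → ℝ) (M : Matrix (Fin n) (Fin n) ℝ) :
    0 ≤ discWith μ M := by
  apply Real.sSup_nonneg
  rintro r ⟨x, y, -, -, rfl⟩
  exact norm_nonneg _

lemma disc_le_discWith {n : ℕ} {μ : Fin n × Fin n → ℝ}
    (hμ : μ ∈ stdSimplex ℝ (Fin n × Fin n)) (M : Matrix (Fin n) (Fin n) ℝ) :
    disc M ≤ discWith μ M :=
  ciInf_le (f := fun μ : stdSimplex ℝ (Fin n × Fin n) => discWith (μ : Fin n × Fin n → ℝ) M)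
    ⟨0, by rintro _ ⟨μ, rfl⟩; exact discWith_nonneg _ _⟩ ⟨μ, hμ⟩

lemma IsComplexDensity.integrableOn {ν : ℝ → ℂ} (h : IsComplexDensity ν) :
    IntegrableOn ν (Ico (0 : ℝ) 1) := by
  obtain ⟨C, hC⟩ := h.bounded
  exact Measure.integrableOn_of_bounded (by simp) h.measurable.aestronglyMeasurable
    (M := C) ((ae_restrict_iff' measurableSet_Ico).2 (ae_of_all _ hC))

lemma norm_setIntegral_mul_le {ν f : ℝ → ℂ} (hν : IntegrableOn ν (Ico (0 : ℝ) 1)) {C : ℝ}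
    (hf : ∀ t ∈ Ico (0 : ℝ) 1, ‖f t‖ ≤ C) :
    ‖∫ t in Ico (0 : ℝ) 1, ν t * f t‖ ≤ (∫ t in Ico (0 : ℝ) 1, ‖ν t‖) * C := by
  rw [← integral_mul_const]
  refine norm_integral_le_of_norm_le (hν.norm.mul_const C) ?_
  refine (ae_restrict_iff' measurableSet_Ico).2 (ae_of_all _ fun t ht => ?_)
  rw [norm_mul]
  exact mul_le_mul_of_nonneg_left (hf t ht) (norm_nonneg _)

/-- The total variation of an absolutely continuous measure is the `L¹`-norm of its density. -/
lemma densityNorm_eq_integral {ν : ℝ → ℂ} (h : IsComplexDensity ν) :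
    densityNorm ν = ∫ t in Ico (0 : ℝ) 1, ‖ν t‖ := by
  have hub : ∀ r ∈ {r : ℝ | ∃ f : ℝ → ℂ, Measurable f ∧
      IsLUB ((fun t => ‖f t‖) '' Ico (0 : ℝ) 1) 1 ∧ r = ‖∫ t in Ico (0 : ℝ) 1, ν t * f t‖},
      r ≤ ∫ t in Ico (0 : ℝ) 1, ‖ν t‖ := by
    rintro r ⟨f, -, hf, rfl⟩
    simpa using norm_setIntegral_mul_le h.integrableOn
      (C := 1) fun t ht => hf.1 (mem_image_of_mem _ ht)
  refine IsGreatest.csSup_eq ⟨?_, hub⟩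
  have hmeas := h.measurable
  -- The conjugate phase of `ν` attains the supremum; the value 1 at zeros of `ν` keeps the modulus
  -- equal to one everywhere.
  refine ⟨fun t => if ν t = 0 then 1 else (starRingEnd ℂ) (ν t) / ‖ν t‖, ?_, ?_, ?_⟩
  · refine Measurable.ite (hmeas (measurableSet_singleton 0)) measurable_const ?_
    exact (Complex.continuous_conj.measurable.comp hmeas).div
      (Complex.measurable_ofReal.comp hmeas.norm)
  · have h1 : ∀ t, ‖(if ν t = 0 then 1 else (starRingEnd ℂ) (ν t) / ‖ν t‖ : ℂ)‖ = 1 := by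
      intro t
      split_ifs with h0
      · simp
      · simp [h0]
    simp only [h1]
    rw [(nonempty_Ico.2 zero_lt_one).image_const]
    exact isLUB_singleton
  · have h2 : ∀ t, ν t * (if ν t = 0 then 1 else (starRingEnd ℂ) (ν t) / ‖ν t‖)
        = ((‖ν t‖ : ℝ) : ℂ) := by
      intro t
      split_ifs with h0
      · simp [h0]
      · have : (‖ν t‖ : ℂ) ≠ 0 := by simpa using h0
        rw [← mul_div_assoc, Complex.mul_conj', pow_two, mul_div_assoc, div_self this, mul_one]
    simp only [h2]
    rw [integral_complex_ofReal, Complex.norm_real,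
      Real.norm_of_nonneg (integral_nonneg fun t => norm_nonneg _)]

/-! ### Upper bound from the Hilbert-type matrix. -/

lemma hilbertMatrix_apply {n : ℕ} (j k : Fin n) :
    hilbertMatrix n j k = 1 / ((((n : ℤ) - (j + 1) - (k + 1) : ℤ) : ℝ) + 1 / 2) := by
  rw [hilbertMatrix]
  push_cast
  ring_nf

/-- The shift by `1/2` keeps the denominators nonzero, with sign positive exactly when the integer
`n - j - k` is nonnegative. -/
lemma greaterThan_mul_abs_hilbertMatrix {n : ℕ} (j k : Fin n) :
    greaterThan n j k * |hilbertMatrix n j k| = hilbertMatrix n j k := by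
  rw [hilbertMatrix_apply, greaterThan]
  split_ifs with h
  · have h0 : (0 : ℤ) ≤ (n : ℤ) - (j + 1) - (k + 1) := by omega
    have h1 : (0 : ℝ) ≤ (((n : ℤ) - (j + 1) - (k + 1) : ℤ) : ℝ) := by exact_mod_cast h0
    rw [abs_of_nonneg (by positivity)]
    ring
  · have h0 : (n : ℤ) - (j + 1) - (k + 1) ≤ -1 := by omega
    have h1 : (((n : ℤ) - (j + 1) - (k + 1) : ℤ) : ℝ) ≤ -1 := by exact_mod_cast h0
    rw [abs_of_nonpos (one_div_nonpos.2 (by linarith))]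
    ring

/-- Hilbert's inequality for the matrix `H`, for vectors in the unit ball of the sup-norm. -/
lemma norm_hilbertMatrix_bilin_le {n : ℕ} {x y : Fin n → ℂ} (hx : ‖x‖ ≤ 1) (hy : ‖y‖ ≤ 1) :
    ‖∑ j, ∑ k, (hilbertMatrix n j k : ℂ) * x j * y k‖ ≤ π * n := by
  have parseval : ∀ z : Fin n → ℂ, ‖z‖ ≤ 1 →
      ∫ t in Ico (0 : ℝ) 1, ‖∑ i : Fin n, z i * circleChar (-((i : ℤ) + 1)) t‖ ^ 2 ≤ n := by
    intro z hz
    rw [integral_norm_sq_trigPoly Finset.univ (fun i : Fin n => -((i : ℤ) + 1))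
      (fun i _ j _ h => Fin.ext (by simpa using h))]
    calc ∑ i, ‖z i‖ ^ 2 ≤ ∑ _i : Fin n, (1 : ℝ) := Finset.sum_le_sum fun i _ =>
          pow_le_one₀ (norm_nonneg _) ((norm_le_pi_norm z i).trans hz)
      _ = n := by simp
  -- Each entry is the coefficient at frequency `n - j - k` of `-iπ e^{πit}`, so the form is one
  -- integral of a product of two trigonometric polynomials against a factor of modulus `π`.
  have h : ∑ j, ∑ k, (hilbertMatrix n j k : ℂ) * x j * y k =
      -(Complex.I * π) * ∫ t in Ico (0 : ℝ) 1, Complex.exp (π * Complex.I * t) * circleChar n t *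
        ((∑ j : Fin n, x j * circleChar (-((j : ℤ) + 1)) t) *
          ∑ k : Fin n, y k * circleChar (-((k : ℤ) + 1)) t) := by
    have hexp : ∀ t : ℝ, Complex.exp (π * Complex.I * t) * circleChar n t *
        ((∑ j : Fin n, x j * circleChar (-((j : ℤ) + 1)) t) *
          ∑ k : Fin n, y k * circleChar (-((k : ℤ) + 1)) t) =
        ∑ j : Fin n, ∑ k : Fin n, x j * y k * (Complex.exp (π * Complex.I * t) *
          circleChar ((n : ℤ) - (j + 1) - (k + 1)) t) := by
      intro t
      rw [Finset.sum_mul_sum, Finset.mul_sum]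
      refine Finset.sum_congr rfl fun j _ => ?_
      rw [Finset.mul_sum]
      refine Finset.sum_congr rfl fun k _ => ?_
      rw [sub_eq_add_neg, sub_eq_add_neg, circleChar_add, circleChar_add]
      ring
    simp_rw [hexp]
    rw [integral_finsetSum _ fun i _ => integrableOn_Ico_of_continuous (by fun_prop),
      Finset.mul_sum]
    refine Finset.sum_congr rfl fun j _ => ?_
    rw [integral_finsetSum _ fun i _ => integrableOn_Ico_of_continuous (by fun_prop),
      Finset.mul_sum]
    refine Finset.sum_congr rfl fun k _ => ?_
    rw [integral_const_mul, hilbertMatrix_apply]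
    have := integral_half_mul_circleChar ((n : ℤ) - (j + 1) - (k + 1))
    push_cast at this ⊢
    rw [← this]
    ring
  rw [h, norm_mul, norm_neg, norm_mul, Complex.norm_I, one_mul, Complex.norm_real,
    Real.norm_of_nonneg pi_pos.le]
  gcongr
  refine (norm_integral_le_integral_norm _).trans ?_
  have hn : ∀ t : ℝ, ‖Complex.exp (π * Complex.I * t)‖ = 1 := by
    intro t
    have : π * Complex.I * t = ((π * t : ℝ) : ℂ) * Complex.I := by
      push_cast
      ring
    rw [this, Complex.norm_exp_ofReal_mul_I]
  simp only [norm_mul, hn, norm_circleChar, one_mul]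
  refine (integral_norm_mul_le (by fun_prop) (by fun_prop)).trans ?_
  linarith [parseval x hx, parseval y hy]

lemma log_add_one_le_sum_one_div (n : ℕ) :
    Real.log (n + 1) ≤ ∑ i ∈ Finset.range n, 1 / ((i : ℝ) + 1) := by
  have h := log_add_one_le_harmonic n
  simpa [harmonic] using h

/-- Enlarging the square adds a row of at least `log (n + 1)`, a column of at least `log (n + 2) -
1` and a corner equal to 2. The left side grows by at most `2 log (n + 1)`, because `n (log (n + 1)
- log n) ≤ 1`. -/
lemma two_mul_mul_log_sub_one_le_sum (n : ℕ) :
    2 * n * (Real.log n - 1) ≤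
      ∑ j ∈ Finset.range n, ∑ k ∈ Finset.range n, |1 / ((j : ℝ) - k - 1 / 2)| := by
  induction n with
  | zero => simp
  | succ n ih =>
    rw [Finset.sum_range_succ]
    simp_rw [Finset.sum_range_succ]
    rw [Finset.sum_add_distrib]
    have hcol : ∑ j ∈ Finset.range n, 1 / (((j + 1 : ℕ) : ℝ) + 1) ≤
        ∑ j ∈ Finset.range n, |1 / ((j : ℝ) - n - 1 / 2)| := by
      rw [← Finset.sum_range_reflect]
      refine Finset.sum_le_sum fun j hj => ?_
      have hj := Finset.mem_range.1 hj
      have hjn : (j : ℝ) + 1 ≤ n := by exact_mod_cast hj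
      have e : ((n - 1 - j + 1 : ℕ) : ℝ) = n - j := by
        rw [show n - 1 - j + 1 = n - j by omega, Nat.cast_sub hj.le]
      rw [e, abs_of_nonpos (one_div_nonpos.2 (by linarith)), ← div_neg]
      exact one_div_le_one_div_of_le (by linarith) (by linarith)
    have hrow : ∑ k ∈ Finset.range n, 1 / ((k : ℝ) + 1) ≤
        ∑ k ∈ Finset.range n, |1 / ((n : ℝ) - k - 1 / 2)| := by
      rw [← Finset.sum_range_reflect]
      refine Finset.sum_le_sum fun k hk => ?_
      have hk := Finset.mem_range.1 hk
      have hkn : (k : ℝ) + 1 ≤ n := by exact_mod_cast hk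
      have e : ((n - 1 - k : ℕ) : ℝ) + 1 = n - k := by
        rw [← Nat.cast_add_one, show n - 1 - k + 1 = n - k by omega, Nat.cast_sub hk.le]
      rw [e, abs_of_nonneg (one_div_nonneg.2 (by linarith))]
      exact one_div_le_one_div_of_le (by linarith) (by linarith)
    have hdiag : |1 / ((n : ℝ) - n - 1 / 2)| = 2 := by norm_num
    have h1 := log_add_one_le_sum_one_div n
    have h2 := log_add_one_le_sum_one_div (n + 1)
    rw [Finset.sum_range_succ'] at h2
    have h3 : Real.log ((n : ℝ) + 1) ≤ Real.log (((n + 1 : ℕ) : ℝ) + 1) :=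
      Real.log_le_log (by positivity) (by push_cast; linarith)
    have h4 : n * Real.log (n + 1) ≤ n * Real.log n + 1 := by
      rcases n.eq_zero_or_pos with rfl | hn
      · simp
      have hn' : (0 : ℝ) < n := by exact_mod_cast hn
      have h5 := Real.log_le_sub_one_of_pos (x := (n + 1 : ℝ) / n) (by positivity)
      rw [Real.log_div (by positivity) hn'.ne'] at h5
      have h6 : (n + 1 : ℝ) / n - 1 = 1 / n := by field_simp; ring
      rw [h6] at h5
      have h7 := mul_le_mul_of_nonneg_left h5 hn'.le
      rw [mul_one_div_cancel hn'.ne'] at h7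
      linarith
    rw [hdiag]
    simp only [Nat.cast_zero, zero_add, div_one] at h2
    push_cast at *
    linarith

lemma two_mul_mul_log_sub_one_le_sum_hilbertMatrix (n : ℕ) :
    2 * n * (Real.log n - 1) ≤ ∑ j, ∑ k, |hilbertMatrix n j k| := by
  refine (two_mul_mul_log_sub_one_le_sum n).trans_eq ?_
  -- Reversing the order of the rows makes the entries depend on a difference of indices, as in the
  -- inductive estimate.
  rw [← Finset.sum_range_reflect, ← Fin.sum_univ_eq_sum_range
    (fun j => ∑ k ∈ Finset.range n, |1 / (((n - 1 - j : ℕ) : ℝ) - k - 1 / 2)|)]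
  refine Finset.sum_congr rfl fun j _ => ?_
  rw [← Fin.sum_univ_eq_sum_range
    (fun k => |1 / (((n - 1 - (j : ℕ) : ℕ) : ℝ) - k - 1 / 2)|)]
  refine Finset.sum_congr rfl fun k _ => ?_
  have e : ((n - 1 - (j : ℕ) : ℕ) : ℝ) = n - 1 - j := by
    have := j.isLt
    rw [Nat.sub_sub, Nat.cast_sub (by omega)]
    push_cast
    ring
  rw [hilbertMatrix, e]
  congr 2
  ring

lemma hilbertDist_mem_stdSimplex {n : ℕ} (h : 0 < ∑ j, ∑ k, |hilbertMatrix n j k|) :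
    hilbertDist n ∈ stdSimplex ℝ (Fin n × Fin n) := by
  refine ⟨fun p => div_nonneg (abs_nonneg _) h.le, ?_⟩
  simp only [hilbertDist]
  rw [← Finset.sum_div, Fintype.sum_prod_type, div_self h.ne']

lemma discWith_hilbertDist_le {n : ℕ} :
    discWith (hilbertDist n) (greaterThan n) ≤ π * n / ∑ j, ∑ k, |hilbertMatrix n j k| := by
  have hS : 0 ≤ ∑ j, ∑ k, |hilbertMatrix n j k| :=
    Finset.sum_nonneg fun j _ => Finset.sum_nonneg fun k _ => abs_nonneg _
  refine Real.sSup_le ?_ (by positivity)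
  rintro r ⟨x, y, hx, hy, rfl⟩
  have h : ∑ j, ∑ k, (greaterThan n j k : ℂ) * (hilbertDist n (j, k) : ℂ) * x j * y k =
      (∑ j, ∑ k, (hilbertMatrix n j k : ℂ) * x j * y k) /
        ((∑ j, ∑ k, |hilbertMatrix n j k| : ℝ) : ℂ) := by
    rw [Finset.sum_div]
    refine Finset.sum_congr rfl fun j _ => ?_
    rw [Finset.sum_div]
    refine Finset.sum_congr rfl fun k _ => ?_
    rw [hilbertDist, ← Complex.ofReal_mul, ← mul_div_assoc, greaterThan_mul_abs_hilbertMatrix,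
      Complex.ofReal_div]
    ring
  rw [h, norm_div, Complex.norm_real, Real.norm_of_nonneg hS]
  exact div_le_div_of_nonneg_right (norm_hilbertMatrix_bilin_le hx.le hy.le) hS

lemma hilbertDist_bound {n : ℕ} (hn : 3 < Real.log n) :
    hilbertDist n ∈ stdSimplex ℝ (Fin n × Fin n) ∧
      discWith (hilbertDist n) (greaterThan n) ≤ π / (2 * (Real.log n - 3)) := by
  have hn0 : (0 : ℝ) < n := by
    rcases n.eq_zero_or_pos with rfl | h
    · norm_num at hn
    · exact_mod_cast h
  have hpos : 0 < 2 * n * (Real.log n - 3) := mul_pos (by positivity) (by linarith)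
  -- The estimate holds with 1 in place of 3; only the weaker form is needed.
  have hS : 2 * n * (Real.log n - 3) ≤ ∑ j, ∑ k, |hilbertMatrix n j k| :=
    (mul_le_mul_of_nonneg_left (by linarith) (by positivity)).trans
      (two_mul_mul_log_sub_one_le_sum_hilbertMatrix n)
  refine ⟨hilbertDist_mem_stdSimplex (hpos.trans_le hS), discWith_hilbertDist_le.trans ?_⟩
  calc π * n / ∑ j, ∑ k, |hilbertMatrix n j k| ≤ π * n / (2 * n * (Real.log n - 3)) :=
        div_le_div_of_nonneg_left (by positivity) hpos hS
    _ = π / (2 * (Real.log n - 3)) := by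
        rw [mul_right_comm, mul_div_mul_right _ _ hn0.ne']

/-! ### Kernels interpolating the step function. -/

/-- Trigonometric polynomial whose transform is the sign of `l + 1/2` for `-m ≤ l < m`. -/
noncomputable def signKernel (m : ℕ) (t : ℝ) : ℂ :=
  ∑ l ∈ Finset.range m, (circleChar (-l) t - circleChar (l + 1) t)

/-- Trigonometric polynomial of bounded `L¹`-norm whose transform is `1` for `|l| ≤ n`. -/
noncomputable def flatKernel (n : ℕ) (t : ℝ) : ℂ :=
  (1 / n) * ((∑ i ∈ Finset.range n, circleChar i t) *
    ∑ j ∈ Finset.range (3 * n), circleChar (n - j) t)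

/-- Trigonometric polynomial whose transform is `1` for `0 ≤ l ≤ n` and `0` for `-n ≤ l < 0`. -/
noncomputable def stepKernel (n : ℕ) (t : ℝ) : ℂ :=
  (1 / 2) * (signKernel (n + 1) t + flatKernel n t)

@[fun_prop]
lemma continuous_signKernel (m : ℕ) : Continuous (signKernel m) := by
  unfold signKernel
  fun_prop

@[fun_prop]
lemma continuous_flatKernel (n : ℕ) : Continuous (flatKernel n) := by
  unfold flatKernel
  fun_prop

@[fun_prop]
lemma continuous_stepKernel (n : ℕ) : Continuous (stepKernel n) := by
  unfold stepKernel
  fun_prop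

lemma isComplexDensity_of_continuous {ν : ℝ → ℂ} (h : Continuous ν) : IsComplexDensity ν := by
  refine ⟨h.measurable, ?_⟩
  obtain ⟨C, hC⟩ := isCompact_Icc.exists_bound_of_continuousOn (s := Icc (0 : ℝ) 1) h.continuousOn
  exact ⟨C, fun t ht => hC t (Ico_subset_Icc_self ht)⟩

lemma densityFourier_signKernel {m : ℕ} {l : ℤ} (h₁ : -(m : ℤ) ≤ l) (h₂ : l < m) :
    densityFourier (signKernel m) l = if 0 ≤ l then 1 else -1 := by
  have h : ∀ t : ℝ, Complex.exp (2 * π * Complex.I * l * t) * signKernel m t =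
      ∑ k ∈ Finset.range m, (circleChar (l - k) t - circleChar (l + (k + 1)) t) := by
    intro t
    rw [signKernel, Finset.mul_sum]
    refine Finset.sum_congr rfl fun k _ => ?_
    rw [sub_eq_add_neg l, circleChar_add l (-k), circleChar_add l (k + 1), mul_sub]
    rfl
  rw [densityFourier]
  simp_rw [h]
  rw [integral_finsetSum _ fun i _ => integrableOn_Ico_of_continuous (by fun_prop)]
  have h' : ∀ k : ℕ, ∫ t in Ico (0 : ℝ) 1, (circleChar (l - k) t - circleChar (l + (k + 1)) t) =
      (if l - k = 0 then 1 else 0) - if l + (k + 1) = 0 then 1 else 0 := by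
    intro k
    rw [integral_sub (integrableOn_Ico_of_continuous (by fun_prop))
      (integrableOn_Ico_of_continuous (by fun_prop)), integral_circleChar, integral_circleChar]
  simp_rw [h']
  split_ifs with h0
  · rw [Finset.sum_eq_single_of_mem l.toNat (Finset.mem_range.2 (by omega))]
    · rw [if_pos (by omega), if_neg (by omega), sub_zero]
    · intro k _ hk
      rw [if_neg (by omega), if_neg (by omega), sub_zero]
  · rw [Finset.sum_eq_single_of_mem (-l - 1).toNat (Finset.mem_range.2 (by omega))]
    · rw [if_neg (by omega), if_pos (by omega), zero_sub]
    · intro k _ hk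
      rw [if_neg (by omega), if_neg (by omega), sub_zero]

lemma densityFourier_flatKernel {n : ℕ} (hn : 1 ≤ n) {l : ℤ} (hl : |l| ≤ n) :
    densityFourier (flatKernel n) l = 1 := by
  have h : ∀ t : ℝ, Complex.exp (2 * π * Complex.I * l * t) * flatKernel n t =
      (1 / n) * ∑ i ∈ Finset.range n, ∑ j ∈ Finset.range (3 * n),
        circleChar (l + (i + (n - j))) t := by
    intro t
    rw [flatKernel, Finset.sum_mul_sum, mul_left_comm, Finset.mul_sum]
    congr 1
    refine Finset.sum_congr rfl fun i _ => ?_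
    rw [Finset.mul_sum]
    refine Finset.sum_congr rfl fun j _ => ?_
    rw [circleChar_add, circleChar_add]
    rfl
  have hl' := abs_le.1 hl
  rw [densityFourier]
  simp_rw [h]
  rw [integral_const_mul,
    integral_finsetSum _ fun i _ => integrableOn_Ico_of_continuous (by fun_prop)]
  have h1 : ∀ i ∈ Finset.range n, ∫ t in Ico (0 : ℝ) 1,
      ∑ j ∈ Finset.range (3 * n), circleChar (l + (i + (n - j))) t = 1 := by
    intro i hi
    have hi := Finset.mem_range.1 hi
    rw [integral_finsetSum _ fun i _ => integrableOn_Ico_of_continuous (by fun_prop)]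
    simp_rw [integral_circleChar]
    -- The window of length `3n` suffices since `0 ≤ l + i + n < 3n`; each `i` thus meets exactly
    -- one `j`.
    rw [Finset.sum_eq_single_of_mem (l + i + n).toNat (Finset.mem_range.2 (by omega))]
    · rw [if_pos (by omega)]
    · intro j _ hj
      rw [if_neg (by omega)]
  rw [Finset.sum_congr rfl h1]
  have : (n : ℂ) ≠ 0 := by exact_mod_cast (by omega : n ≠ 0)
  simp [this]

lemma densityFourier_stepKernel {n : ℕ} (hn : 1 ≤ n) {l : ℤ} (hl : |l| ≤ n) :
    densityFourier (stepKernel n) l = if 0 ≤ l then 1 else 0 := by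
  have hl' := abs_le.1 hl
  have h : densityFourier (stepKernel n) l =
      (1 / 2) * (densityFourier (signKernel (n + 1)) l + densityFourier (flatKernel n) l) := by
    rw [densityFourier, densityFourier, densityFourier,
      ← integral_add (integrableOn_Ico_of_continuous (by fun_prop))
        (integrableOn_Ico_of_continuous (by fun_prop)), ← integral_const_mul]
    congr 1
    funext t
    rw [stepKernel]
    ring
  rw [h, densityFourier_flatKernel hn hl,
    densityFourier_signKernel (by push_cast; omega) (by push_cast; omega)]
  split_ifs <;> norm_num

/-- The two factors have square integrals `n` and `3n`, so the bound is `(1/n) (n + 3n) / 2 = 2`. -/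
lemma integral_norm_flatKernel_le {n : ℕ} (hn : 1 ≤ n) :
    ∫ t in Ico (0 : ℝ) 1, ‖flatKernel n t‖ ≤ 2 := by
  have hn' : (0 : ℝ) < n := by exact_mod_cast hn
  simp only [flatKernel, norm_mul]
  rw [integral_const_mul]
  have h1 := integral_norm_sq_trigPoly (Finset.range n) (fun i => (i : ℤ))
    (fun i _ j _ h => by simpa using h) 1
  have h2 := integral_norm_sq_trigPoly (Finset.range (3 * n)) (fun j => (n : ℤ) - j)
    (fun i _ j _ h => by simpa using h) 1
  simp only [Pi.one_apply, one_mul, norm_one, one_pow, Finset.sum_const, Finset.card_range,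
    nsmul_eq_mul, mul_one] at h1 h2
  have h3 := integral_norm_mul_le (f := fun t => ∑ i ∈ Finset.range n, circleChar i t)
    (g := fun t => ∑ j ∈ Finset.range (3 * n), circleChar (n - j) t) (by fun_prop) (by fun_prop)
  rw [h1, h2] at h3
  refine (mul_le_mul_of_nonneg_left h3 (norm_nonneg _)).trans_eq ?_
  simp only [norm_div, norm_one, Complex.norm_natCast]
  push_cast
  field_simp
  norm_num

/-- The sum telescopes, since `sin ((2l+1)s) sin s = sin² ((l+1)s) - sin² (ls)`. The resulting
nonnegativity lets the norm of `signKernel` be integrated term by term. -/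
lemma sum_sin_odd_mul_sin (m : ℕ) (s : ℝ) :
    (∑ l ∈ Finset.range m, Real.sin ((2 * l + 1) * s)) * Real.sin s = Real.sin (m * s) ^ 2 := by
  induction m with
  | zero => simp
  | succ m ih =>
    rw [Finset.sum_range_succ, add_mul, ih]
    have h1 : (2 * (m : ℝ) + 1) * s = m * s + (m * s + s) := by ring
    have h2 : ((m + 1 : ℕ) : ℝ) * s = m * s + s := by
      push_cast
      ring
    rw [h1, h2, Real.sin_add (m * s) (m * s + s), Real.sin_add, Real.cos_add]
    linear_combination -(Real.sin (m * s) ^ 2) * Real.sin_sq_add_cos_sq s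

lemma sum_sin_odd_nonneg (m : ℕ) {t : ℝ} (ht : t ∈ Ico (0 : ℝ) 1) :
    0 ≤ ∑ l ∈ Finset.range m, Real.sin ((2 * l + 1) * (π * t)) := by
  rcases ht.1.eq_or_lt with rfl | h0
  · simp
  · have hs : 0 < Real.sin (π * t) := Real.sin_pos_of_pos_of_lt_pi (by positivity)
      (by nlinarith [ht.2, pi_pos])
    refine nonneg_of_mul_nonneg_left ?_ hs
    rw [sum_sin_odd_mul_sin]
    positivity

/-- The paired frequencies `-l` and `l + 1` are symmetric about `1/2`; factoring out `e^{πit}`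
leaves sines of odd multiples of `πt`. -/
lemma norm_signKernel (m : ℕ) {t : ℝ} (ht : t ∈ Ico (0 : ℝ) 1) :
    ‖signKernel m t‖ = 2 * ∑ l ∈ Finset.range m, Real.sin ((2 * l + 1) * (π * t)) := by
  have h : signKernel m t = -2 * Complex.I * Complex.exp ((π * t : ℝ) * Complex.I) *
      ((∑ l ∈ Finset.range m, Real.sin ((2 * l + 1) * (π * t)) : ℝ) : ℂ) := by
    rw [signKernel, Complex.ofReal_sum, Finset.mul_sum]
    refine Finset.sum_congr rfl fun l _ => ?_
    rw [Complex.ofReal_sin, Complex.sin, circleChar, circleChar]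
    have e1 : Complex.exp (2 * π * Complex.I * ((-(l : ℤ) : ℤ) : ℂ) * t) =
        Complex.exp ((π * t : ℝ) * Complex.I) *
          Complex.exp (-(((2 * l + 1) * (π * t) : ℝ) : ℂ) * Complex.I) := by
      rw [← Complex.exp_add]
      push_cast
      ring_nf
    have e2 : Complex.exp (2 * π * Complex.I * (((l : ℤ) + 1 : ℤ) : ℂ) * t) =
        Complex.exp ((π * t : ℝ) * Complex.I) *
          Complex.exp ((((2 * l + 1) * (π * t) : ℝ) : ℂ) * Complex.I) := by
      rw [← Complex.exp_add]
      push_cast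
      ring_nf
    rw [e1, e2]
    linear_combination (Complex.exp ((π * t : ℝ) * Complex.I) *
      (Complex.exp (-(((2 * l + 1) * (π * t) : ℝ) : ℂ) * Complex.I) -
        Complex.exp ((((2 * l + 1) * (π * t) : ℝ) : ℂ) * Complex.I))) * Complex.I_sq
  rw [h, norm_mul, norm_mul, Complex.norm_exp_ofReal_mul_I, Complex.norm_real,
    Real.norm_of_nonneg (sum_sin_odd_nonneg m ht)]
  simp

lemma integral_sin_odd (l : ℕ) :
    ∫ t in Ico (0 : ℝ) 1, Real.sin ((2 * l + 1) * (π * t)) = 2 / π * (1 / (2 * l + 1)) := by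
  have hc : (2 * (l : ℝ) + 1) * π ≠ 0 := by positivity
  simp_rw [← mul_assoc]
  rw [setIntegral_Ico_eq_intervalIntegral,
    intervalIntegral.integral_comp_mul_left (fun s => Real.sin s) hc, integral_sin]
  have h1 : Real.cos ((2 * (l : ℝ) + 1) * π * 1) = -1 := by
    rw [show (2 * (l : ℝ) + 1) * π * 1 = π + l * (2 * π) by ring, Real.cos_add_nat_mul_two_pi,
      Real.cos_pi]
  rw [h1, mul_zero, Real.cos_zero, smul_eq_mul]
  field_simp
  norm_num

lemma sum_one_div_odd_le (n : ℕ) :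
    ∑ l ∈ Finset.range (n + 1), 1 / (2 * (l : ℝ) + 1) ≤ 1 + Real.log (2 * n + 1) / 2 := by
  induction n with
  | zero => simp
  | succ n ih =>
    rw [Finset.sum_range_succ]
    have h := Real.one_sub_inv_le_log_of_pos (x := (2 * n + 3 : ℝ) / (2 * n + 1)) (by positivity)
    rw [Real.log_div (by positivity) (by positivity)] at h
    have e : 1 - ((2 * n + 3 : ℝ) / (2 * n + 1))⁻¹ = 2 * (1 / (2 * n + 3)) := by
      field_simp
      norm_num
    have e2 : 2 * ((n + 1 : ℕ) : ℝ) + 1 = 2 * n + 3 := by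
      push_cast
      ring
    rw [e] at h
    rw [e2]
    linarith

/-- The constant is chosen so that `2 + 1.14 = 3.14 < π`, which yields the additive constant 2 in
the norm bound. -/
lemma log_three_le : Real.log 3 ≤ 1.14 := by
  rw [Real.log_le_iff_le_exp (by norm_num)]
  refine le_trans ?_ (Real.sum_le_exp_of_nonneg (x := 1.14) (by norm_num) 4)
  norm_num [Finset.sum_range_succ, Nat.factorial]

lemma integral_norm_stepKernel_le {n : ℕ} (hn : 1 ≤ n) :
    ∫ t in Ico (0 : ℝ) 1, ‖stepKernel n t‖ ≤ Real.log n / π + 2 := by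
  have hn' : (1 : ℝ) ≤ n := by exact_mod_cast hn
  have h1 : ∫ t in Ico (0 : ℝ) 1, ‖stepKernel n t‖ ≤
      ((∫ t in Ico (0 : ℝ) 1, ‖signKernel (n + 1) t‖) +
        ∫ t in Ico (0 : ℝ) 1, ‖flatKernel n t‖) / 2 := by
    rw [← integral_add (integrableOn_Ico_of_continuous (by fun_prop))
      (integrableOn_Ico_of_continuous (by fun_prop)), ← integral_div]
    refine integral_mono (integrableOn_Ico_of_continuous (by fun_prop))
      (integrableOn_Ico_of_continuous (by fun_prop)) fun t => ?_
    change ‖stepKernel n t‖ ≤ (‖signKernel (n + 1) t‖ + ‖flatKernel n t‖) / 2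
    rw [stepKernel, norm_mul]
    have := norm_add_le (signKernel (n + 1) t) (flatKernel n t)
    norm_num
    linarith
  have h2 : ∫ t in Ico (0 : ℝ) 1, ‖signKernel (n + 1) t‖ ≤
      4 / π * (1 + Real.log (2 * n + 1) / 2) := by
    rw [setIntegral_congr_fun measurableSet_Ico fun t ht => norm_signKernel (n + 1) ht,
      integral_const_mul,
      integral_finsetSum _ fun i _ => integrableOn_Ico_of_continuous (by fun_prop)]
    simp_rw [integral_sin_odd]
    rw [← Finset.mul_sum, ← mul_assoc, ← mul_div_assoc]
    norm_num only
    exact mul_le_mul_of_nonneg_left (sum_one_div_odd_le n) (by positivity)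
  have h3 : Real.log (2 * n + 1) ≤ Real.log n + 1.14 := by
    refine (Real.log_le_log (by positivity) (by linarith : (2 * n + 1 : ℝ) ≤ n * 3)).trans ?_
    rw [Real.log_mul (by positivity) (by norm_num)]
    linarith [log_three_le]
  have h4 : 4 / π * (1 + Real.log (2 * n + 1) / 2) ≤ 2 * (Real.log n / π) + 2 := by
    calc 4 / π * (1 + Real.log (2 * n + 1) / 2) ≤ 4 / π * (1 + (Real.log n + 1.14) / 2) := by
          gcongr
      _ = 2 * (Real.log n / π) + 2 * (3.14 / π) := by
          field_simp
          ring
      _ ≤ 2 * (Real.log n / π) + 2 := by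
          have : 3.14 / π ≤ 1 := (div_le_one pi_pos).2 pi_gt_d2.le
          linarith
  linarith [integral_norm_flatKernel_le hn]

/-! ### Duality and the lower bound. -/

lemma one_le_densityNorm {ν : ℝ → ℂ} (hν : IsComplexDensity ν) (h : densityFourier ν 0 = 1) :
    1 ≤ densityNorm ν := by
  have h1 : ‖densityFourier ν 0‖ ≤ ∫ t in Ico (0 : ℝ) 1, ‖ν t‖ := by
    simpa [densityFourier] using norm_integral_le_integral_norm (μ := volume.restrict (Ico 0 1)) ν
  rwa [h, norm_one, ← densityNorm_eq_integral hν] at h1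

/-- Duality between the discrepancy and densities interpolating the step function. -/
lemma one_le_two_mul_densityNorm_mul_discWith {n : ℕ} (hn : 1 ≤ n) {ν : ℝ → ℂ}
    (hν : IsComplexDensity ν)
    (h : ∀ l : ℤ, |l| ≤ (n : ℤ) → densityFourier ν l = if 0 ≤ l then 1 else 0)
    {μ : Fin n × Fin n → ℝ} (hμ : μ ∈ stdSimplex ℝ (Fin n × Fin n)) :
    1 ≤ 2 * densityNorm ν * discWith μ (greaterThan n) := by
  have : Nonempty (Fin n) := ⟨⟨0, hn⟩⟩
  have hint := hν.integrableOn
  have hchar : ∀ (p : Fin n → ℤ) (t : ℝ), ‖fun i => circleChar (p i) t‖ = 1 := by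
    intro p t
    refine le_antisymm ((pi_norm_le_iff_of_nonneg zero_le_one).2
      fun i => (norm_circleChar _ _).le) ?_
    rw [← norm_circleChar (p ⟨0, hn⟩) t]
    exact norm_le_pi_norm (fun i => circleChar (p i) t) ⟨0, hn⟩
  have key : ∀ p q : Fin n → ℤ,
      ‖∑ j, ∑ k, (greaterThan n j k : ℂ) * (μ (j, k) : ℂ) * densityFourier ν (p j + q k)‖ ≤
        densityNorm ν * discWith μ (greaterThan n) := by
    intro p q
    have hi : ∀ l : ℤ, IntegrableOn (fun t => circleChar l t * ν t) (Ico (0 : ℝ) 1) := fun l =>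
      Integrable.bdd_mul hint (continuous_circleChar l).aestronglyMeasurable
        (ae_of_all _ fun t => (norm_circleChar l t).le)
    have e : ∑ j, ∑ k, (greaterThan n j k : ℂ) * (μ (j, k) : ℂ) * densityFourier ν (p j + q k) =
        ∫ t in Ico (0 : ℝ) 1, ν t * ∑ j, ∑ k, (greaterThan n j k : ℂ) * (μ (j, k) : ℂ) *
          circleChar (p j) t * circleChar (q k) t := by
      have e1 : ∀ t : ℝ, ν t * ∑ j, ∑ k, (greaterThan n j k : ℂ) * (μ (j, k) : ℂ) *
          circleChar (p j) t * circleChar (q k) t =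
          ∑ j, ∑ k, (greaterThan n j k : ℂ) * (μ (j, k) : ℂ) *
            (circleChar (p j + q k) t * ν t) := by
        intro t
        rw [Finset.mul_sum]
        refine Finset.sum_congr rfl fun j _ => ?_
        rw [Finset.mul_sum]
        refine Finset.sum_congr rfl fun k _ => ?_
        rw [circleChar_add]
        ring
      simp_rw [e1]
      rw [integral_finsetSum _ fun j _ => integrable_finsetSum _ fun k _ => (hi _).const_mul _]
      refine Finset.sum_congr rfl fun j _ => ?_
      rw [integral_finsetSum _ fun k _ => (hi _).const_mul _]
      refine Finset.sum_congr rfl fun k _ => ?_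
      rw [integral_const_mul]
      rfl
    rw [e, densityNorm_eq_integral hν]
    exact norm_setIntegral_mul_le hint fun t _ => le_discWith μ _ (hchar p t) (hchar q t)
  -- With 1-based indices the frequencies are `n - j - k` and `j + k - n - 1 = -(n - j - k) - 1`.
  -- Exactly one is nonnegative, so the difference of the two transforms is `G`.
  have k1 := key (fun j => -((j : ℤ) + 1)) (fun k => n - (k + 1))
  have k2 := key (fun j => (j : ℤ) + 1) (fun k => (k + 1) - n - 1)
  -- Since the entries of `G` square to 1, pairing `G μ` with `G` returns the total mass of `μ`.
  have hone : (1 : ℂ) =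
      (∑ j : Fin n, ∑ k : Fin n, (greaterThan n j k : ℂ) * (μ (j, k) : ℂ) *
        densityFourier ν (-((j : ℤ) + 1) + (n - (k + 1)))) -
      ∑ j : Fin n, ∑ k : Fin n, (greaterThan n j k : ℂ) * (μ (j, k) : ℂ) *
        densityFourier ν ((j : ℤ) + 1 + ((k + 1) - n - 1)) := by
    have hsum : ∑ j, ∑ k, (μ (j, k) : ℂ) = 1 := by
      rw [← Fintype.sum_prod_type (fun p : Fin n × Fin n => (μ p : ℂ)), ← Complex.ofReal_sum,
        hμ.2, Complex.ofReal_one]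
    rw [← hsum, ← Finset.sum_sub_distrib]
    refine Finset.sum_congr rfl fun j _ => ?_
    rw [← Finset.sum_sub_distrib]
    refine Finset.sum_congr rfl fun k _ => ?_
    have hj := j.isLt
    have hk := k.isLt
    rw [h _ (abs_le.2 ⟨by omega, by omega⟩), h _ (abs_le.2 ⟨by omega, by omega⟩), greaterThan]
    by_cases hjk : (j.val + 1) + (k.val + 1) ≤ n
    · rw [if_pos hjk, if_pos (by omega), if_neg (by omega)]
      push_cast
      ring
    · rw [if_neg hjk, if_neg (by omega), if_pos (by omega)]
      push_cast
      ring
  have h1 := norm_sub_le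
    (∑ j : Fin n, ∑ k : Fin n, (greaterThan n j k : ℂ) * (μ (j, k) : ℂ) *
      densityFourier ν (-((j : ℤ) + 1) + (n - (k + 1))))
    (∑ j : Fin n, ∑ k : Fin n, (greaterThan n j k : ℂ) * (μ (j, k) : ℂ) *
      densityFourier ν ((j : ℤ) + 1 + ((k + 1) - n - 1)))
  rw [← hone, norm_one] at h1
  linarith

lemma one_div_two_mul_densityNorm_le_disc {n : ℕ} (hn : 1 ≤ n) {ν : ℝ → ℂ}
    (hν : IsComplexDensity ν)
    (h : ∀ l : ℤ, |l| ≤ (n : ℤ) → densityFourier ν l = if 0 ≤ l then 1 else 0) :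
    1 / (2 * densityNorm ν) ≤ disc (greaterThan n) := by
  have : Nonempty (Fin n) := ⟨⟨0, hn⟩⟩
  have hpos : 1 ≤ densityNorm ν := one_le_densityNorm hν (by simpa using h 0 (by simp))
  refine le_ciInf fun μ => ?_
  rw [div_le_iff₀' (by linarith)]
  exact one_le_two_mul_densityNorm_mul_discWith hn hν h μ.2

lemma exists_density_step {n : ℕ} (hn : 1 ≤ n) :
    ∃ ν : ℝ → ℂ, IsComplexDensity ν ∧
      (∀ l : ℤ, |l| ≤ (n : ℤ) → densityFourier ν l = if 0 ≤ l then 1 else 0) ∧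
      densityNorm ν ≤ Real.log n / π + 2 ∧
      1 / (2 * densityNorm ν) ≤ disc (greaterThan n) := by
  have hν := isComplexDensity_of_continuous (continuous_stepKernel n)
  have h : ∀ l : ℤ, |l| ≤ (n : ℤ) →
      densityFourier (stepKernel n) l = if 0 ≤ l then 1 else 0 :=
    fun l hl => densityFourier_stepKernel hn hl
  refine ⟨stepKernel n, hν, h, ?_, one_div_two_mul_densityNorm_le_disc hn hν h⟩
  rw [densityNorm_eq_integral hν]
  exact integral_norm_stepKernel_le hn

/-! ### The asymptotic formula. -/

lemma disc_greaterThan_isEquivalent :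
    (fun n : ℕ => disc (greaterThan n)) ~[atTop] (fun n : ℕ => π / (2 * Real.log n)) := by
  have hlog : Tendsto (fun n : ℕ => Real.log n) atTop atTop :=
    Real.tendsto_log_atTop.comp tendsto_natCast_atTop_atTop
  have hratio : ∀ c : ℝ, Tendsto (fun n : ℕ => Real.log n / (Real.log n + c)) atTop (𝓝 1) := by
    intro c
    have h0 : Tendsto (fun n : ℕ => 1 - c / (Real.log n + c)) atTop (𝓝 (1 - 0)) :=
      tendsto_const_nhds.sub ((tendsto_atTop_add_const_right _ c hlog).const_div_atTop c)
    rw [sub_zero] at h0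
    refine h0.congr' ?_
    filter_upwards [hlog.eventually_gt_atTop (-c)] with n hn
    have : Real.log n + c ≠ 0 := by linarith
    field_simp
    ring
  have hpos := pi_pos
  refine (isEquivalent_iff_tendsto_one ?_).2 ?_
  · filter_upwards [hlog.eventually_gt_atTop 0] with n hn
    positivity
  -- The shift `2π` comes from `ln n / π + 2 = (ln n + 2π) / π`, the shift `-3` from the bound for
  -- the Hilbert weights.
  refine tendsto_of_tendsto_of_tendsto_of_le_of_le' (hratio (2 * π)) (hratio (-3)) ?_ ?_
  · filter_upwards [hlog.eventually_gt_atTop 0, eventually_ge_atTop 1] with n hn hn1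
    obtain ⟨ν, hν, h, hle, hdisc⟩ := exists_density_step hn1
    have h1 : 1 ≤ densityNorm ν := one_le_densityNorm hν (by simpa using h 0 (by simp))
    rw [Pi.div_apply, le_div_iff₀ (by positivity)]
    refine le_trans ?_ hdisc
    calc Real.log n / (Real.log n + 2 * π) * (π / (2 * Real.log n))
        = 1 / (2 * (Real.log n / π + 2)) := by field_simp
      _ ≤ 1 / (2 * densityNorm ν) :=
        one_div_le_one_div_of_le (by linarith) (by linarith)
  · filter_upwards [hlog.eventually_gt_atTop 3] with n hn
    obtain ⟨hmem, hle⟩ := hilbertDist_bound hn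
    have hlog0 : 0 < Real.log n := by linarith
    have h3 : Real.log n - 3 ≠ 0 := by linarith
    rw [Pi.div_apply, div_le_iff₀ (by positivity)]
    refine ((disc_le_discWith hmem _).trans hle).trans_eq ?_
    rw [← sub_eq_add_neg]
    field_simp

theorem mainTheorem1 :
    ((fun n : ℕ => disc (greaterThan n)) ~[atTop] (fun n : ℕ => π / (2 * Real.log n))) ∧
    (∀ n : ℕ, 3 < Real.log n →
      hilbertDist n ∈ stdSimplex ℝ (Fin n × Fin n) ∧
      discWith (hilbertDist n) (greaterThan n) ≤ π / (2 * (Real.log n - 3))) ∧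
    (∀ n : ℕ, 1 ≤ n →
      ∃ ν : ℝ → ℂ, IsComplexDensity ν ∧
        (∀ l : ℤ, |l| ≤ (n : ℤ) → densityFourier ν l = if 0 ≤ l then 1 else 0) ∧
        densityNorm ν ≤ Real.log n / π + 2 ∧
        1 / (2 * densityNorm ν) ≤ disc (greaterThan n)) := by
  exact ⟨disc_greaterThan_isEquivalent, fun _ hn => hilbertDist_bound hn,
    fun _ hn => exists_density_step hn⟩
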